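/- Consider the two-dimensional Fornasini–Marchesini II system $$x(i+1,j+1)=A_1x(i,j+1)+A_2x(i+1,j)+B_1u(i,j+1)+B_2u(i+1,j)+\sum_{k=1}^{2}\bigl(L_k^1f_k(i,j+1)+L_k^2f_k(i+1,j)\bigr),\qquad y(i,j)=Cx(i,j),$$ with $x\in\mathbb R^n$, $u\in\mathbb R^m$, $y\in\mathbb R^q$, two scalar faults $f_1,f_2$, on the half plane $i+j\ge 0$, with arbitrary initial values on $i+j=0$. For matrices $F_1,F_2$ and a subspace $K$ let $\langle K\,|\,F_1,F_2\rangle$ be the largest subspace of $K$ that is invariant under $F_1$ and $F_2$. A subspace of $\mathbb R^n$ is an unobservability subspace if it equals $\langle\ker HC\,|\,A_1+D_1C,\,A_2+D_2C\rangle$ for some matrices $D_1,D_2,H$. Let $\mathcal L_k=\mathrm{span}\{L_k^1,L_k^2\}$ and let $\mathcal S_1^*$ be the smallest unobservability subspace containing $\mathcal L_2$ (it exists). A quotient subsystem $(M,A_1^p,A_2^p)$ for $f_1$ is given by matrices $D_1,D_2,H$ with $\ker HC=\mathcal S_1^*+\ker C$, the canonical projection $P:\mathbb R^n\to\mathbb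 R^n/\mathcal S_1^*$ written in coordinates, and $A_i^pP=P(A_i+D_iC)$ for $i=1,2$, $MP=HC$. A minimal left annihilator of $$\mathrm{PBH}(z_1,z_2)=\begin{bmatrix}I-z_1A_1^p-z_2A_2^p\\ M\end{bmatrix}$$ is a polynomial matrix $N(z_1,z_2)$ of full row rank with $N\,\mathrm{PBH}=0$ such that every polynomial $N'$ with $N'\,\mathrm{PBH}=0$ has the form $N_3N$ with $N_3$ polynomial. Suppose that 1. $\mathcal L_1\not\subseteq\mathcal S_1^*$, and 2. for some quotient subsystem and some minimal left annihilator $N$ of its PBH matrix, $\operatorname{rank}\Bigl(N(z_1,z_2)\begin{bmatrix}z_1PL_1^1+z_2PL_1^2\\0\end{bmatrix}\Bigr)=1$ for all $z_1,z_2\in\mathbb C\setminus\{0\}$. Then the FDI problem is solvable for $f_1$ by a delayed deadbeat filter, that is: (a) $f_1$ is detectable and isolable: there are $D_1,D_2,H$ such that the invariant unobservable subspace $\langle\ker HC\,|\,A_1+D_1C,A_2+D_2C\rangle$ contains $\mathcal L_2$ but not $\mathcal L_1$; (b) there is a filter $$\hat\omega(i+1,j+1)=F_1\hat\omega(i,j+1)+F_2\hat\omega(i+1,j)+K_1u(i,j+1)+K_2u(i+1,j)+E_1y(i,j+1)+E_2y(i+1,j),$$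 $$r(i,j)=M_f\hat\omega(i,j)-H_fy(i,j)\in\mathbb R$$ and integers $n_1,n_2\ge 0$ with $n_1+n_2>0$, and $N_0\ge n_1+n_2$, such that for all initial values of the system and of the filter on $i+j=0$, all $u$, $f_1$ and $f_2$, $$r(i,j)=f_1(i-n_1,j-n_2)\quad\text{whenever } i+j>N_0;$$ (c) for the same filter, $r$ is a residual for $f_1$: for all $u,f_2$ and all initial values, if $f_1=0$ then $r(i,j)\to0$ as $i+j\to\infty$; there is $N_1$ such that $f_1(i,j)\ne0$ for some $i+j>N_1$ implies $r\neq0$; and if system and filter have zero initial values, then $f_1\ne0$ implies $r\ne0$. The same holds with the roles of $f_1$ and $f_2$ exchanged; hence, if the hypotheses hold for both faults, the complete FDI problem (one such filter and residual for each fault) is solvable. -/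

import Mathlib

open Matrix Filter Topology

noncomputable section

namespace TwoDFDI

/-! ### Invariant, conditioned invariant and unobservability subspaces -/

/-- The subspace `V` of `ℝⁿ` is mapped into itself by `A`. -/
def Invariant {n : ℕ} (A : Matrix (Fin n) (Fin n) ℝ) (V : Submodule ℝ (Fin n → ℝ)) : Prop :=
  ∀ x ∈ V, A *ᵥ x ∈ V

/-- `⟨K | A₁,₂⟩`: the largest subspace contained in `K` that is invariant under `A₁` and `A₂`. -/
def largestInvariant {n : ℕ} (A₁ A₂ : Matrix (Fin n) (Fin n) ℝ)
    (K : Submodule ℝ (Fin n → ℝ)) : Submodule ℝ (Fin n → ℝ) :=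
  sSup {V | V ≤ K ∧ Invariant A₁ V ∧ Invariant A₂ V}

/-- The (finite) invariant unobservable subspace of the triple `(C, A₁, A₂)`. -/
def invariantUnobservable {n q : ℕ} (C : Matrix (Fin q) (Fin n) ℝ)
    (A₁ A₂ : Matrix (Fin n) (Fin n) ℝ) : Submodule ℝ (Fin n → ℝ) :=
  largestInvariant A₁ A₂ (LinearMap.ker C.mulVecLin)

/-- `V` is a (finite) unobservability subspace of `(C, A₁, A₂)`: there are maps `D₁`, `D₂`, `H`
with `V = ⟨ker HC | [A + DC]₁,₂⟩`. -/
def IsUnobservabilitySubspace {n q : ℕ} (C : Matrix (Fin q) (Fin n) ℝ)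
    (A₁ A₂ : Matrix (Fin n) (Fin n) ℝ) (V : Submodule ℝ (Fin n → ℝ)) : Prop :=
  ∃ (D₁ D₂ : Matrix (Fin n) (Fin q) ℝ) (h : ℕ) (H : Matrix (Fin h) (Fin q) ℝ),
    V = invariantUnobservable (H * C) (A₁ + D₁ * C) (A₂ + D₂ * C)

/-- The smallest (finite) unobservability subspace of `(C, A₁, A₂)` that contains `K`
(see `isLeast_smallestUnobservability`). -/
def smallestUnobservability {n q : ℕ} (C : Matrix (Fin q) (Fin n) ℝ)
    (A₁ A₂ : Matrix (Fin n) (Fin n) ℝ) (K : Submodule ℝ (Fin n → ℝ)) :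
    Submodule ℝ (Fin n → ℝ) :=
  sInf {V | IsUnobservabilitySubspace C A₁ A₂ V ∧ K ≤ V}

theorem invariant_sSup {n : ℕ} (A : Matrix (Fin n) (Fin n) ℝ)
    (s : Set (Submodule ℝ (Fin n → ℝ))) (hs : ∀ V ∈ s, Invariant A V) :
    Invariant A (sSup s) := by
  have key : sSup s ≤ (sSup s).comap A.mulVecLin := by
    refine sSup_le fun V hV x hx => ?_
    exact (le_sSup hV : V ≤ sSup s) (hs V hV x hx)
  exact fun x hx => key hx

theorem largestInvariant_spec {n : ℕ} (A₁ A₂ : Matrix (Fin n) (Fin n) ℝ)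
    (K : Submodule ℝ (Fin n → ℝ)) :
    IsGreatest {V | V ≤ K ∧ Invariant A₁ V ∧ Invariant A₂ V} (largestInvariant A₁ A₂ K) := by
  refine ⟨⟨sSup_le fun V hV => hV.1, ?_, ?_⟩, fun V hV => le_sSup hV⟩
  · exact invariant_sSup _ _ fun V hV => hV.2.1
  · exact invariant_sSup _ _ fun V hV => hV.2.2

theorem exists_injection {n q : ℕ} (C : Matrix (Fin q) (Fin n) ℝ)
    (W : Submodule ℝ (Fin n → ℝ)) :
    ∃ G : Matrix (Fin n) (Fin q) ℝ, (∀ y, G *ᵥ y ∈ W) ∧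
      ∀ w ∈ W, C *ᵥ (w - G *ᵥ (C *ᵥ w)) = 0 := by
  let f : W →ₗ[ℝ] (Fin q → ℝ) := C.mulVecLin ∘ₗ W.subtype
  obtain ⟨s, hs⟩ := f.rangeRestrict.exists_rightInverse_of_surjective
    (LinearMap.range_rangeRestrict f)
  obtain ⟨g, hg⟩ := LinearMap.exists_extend s
  refine ⟨LinearMap.toMatrix' (W.subtype ∘ₗ g), fun y => ?_, fun w hw => ?_⟩
  · rw [LinearMap.toMatrix'_mulVec]
    exact (g y).2
  · rw [LinearMap.toMatrix'_mulVec]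
    have h1 : g (f ⟨w, hw⟩) = s (f.rangeRestrict ⟨w, hw⟩) := by
      rw [← hg]; rfl
    have h2 : f (s (f.rangeRestrict ⟨w, hw⟩)) = f ⟨w, hw⟩ := by
      have := congrArg (fun φ => ((φ (f.rangeRestrict ⟨w, hw⟩) : LinearMap.range f) :
        Fin q → ℝ)) hs
      simpa using this
    rw [← h1] at h2
    rw [Matrix.mulVec_sub, sub_eq_zero]
    exact h2.symm

theorem exists_output_map {q : ℕ} (U : Submodule ℝ (Fin q → ℝ)) :
    ∃ H : Matrix (Fin q) (Fin q) ℝ, ∀ y, H *ᵥ y = 0 ↔ y ∈ U := by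
  obtain ⟨f, hf⟩ := U.exists_isCompl
  refine ⟨LinearMap.toMatrix' (f.subtype ∘ₗ f.projectionOnto U hf.symm), fun y => ?_⟩
  rw [LinearMap.toMatrix'_mulVec]
  simp

/-- The smallest unobservability subspace containing a given subspace exists. -/
theorem isLeast_smallestUnobservability {n q : ℕ} (C : Matrix (Fin q) (Fin n) ℝ)
    (A₁ A₂ : Matrix (Fin n) (Fin n) ℝ) (K : Submodule ℝ (Fin n → ℝ)) :
    IsLeast {V | IsUnobservabilitySubspace C A₁ A₂ V ∧ K ≤ V}
      (smallestUnobservability C A₁ A₂ K) := by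
  suffices h : ∃ S, IsLeast {V | IsUnobservabilitySubspace C A₁ A₂ V ∧ K ≤ V} S by
    obtain ⟨S, hS⟩ := h
    have : smallestUnobservability C A₁ A₂ K = S := hS.csInf_eq
    rwa [this]
  -- the minimal conditioned invariant subspace containing `K`
  let W : Submodule ℝ (Fin n → ℝ) :=
    sInf {W | K ≤ W ∧ ∀ x ∈ W, C *ᵥ x = 0 → A₁ *ᵥ x ∈ W ∧ A₂ *ᵥ x ∈ W}
  have hKW : K ≤ W := le_sInf fun V hV => hV.1
  have hWc : ∀ x ∈ W, C *ᵥ x = 0 → A₁ *ᵥ x ∈ W ∧ A₂ *ᵥ x ∈ W := by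
    intro x hx hC
    constructor
    · refine (Submodule.mem_sInf).2 fun V hV => ?_
      exact (hV.2 x ((Submodule.mem_sInf).1 hx V hV) hC).1
    · refine (Submodule.mem_sInf).2 fun V hV => ?_
      exact (hV.2 x ((Submodule.mem_sInf).1 hx V hV) hC).2
  obtain ⟨G, hGW, hG⟩ := exists_injection C W
  have hsub : ∀ w ∈ W, w - G *ᵥ (C *ᵥ w) ∈ W := fun w hw => W.sub_mem hw (hGW _)
  have hexp : ∀ (A : Matrix (Fin n) (Fin n) ℝ) (w : Fin n → ℝ),
      (A + -(A * G) * C) *ᵥ w = A *ᵥ (w - G *ᵥ (C *ᵥ w)) := by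
    intro A w
    rw [Matrix.add_mulVec, Matrix.mulVec_sub, Matrix.neg_mul, Matrix.neg_mulVec,
      Matrix.mulVec_mulVec, Matrix.mulVec_mulVec, Matrix.mul_assoc, sub_eq_add_neg]
  obtain ⟨H, hH⟩ := exists_output_map (W.map C.mulVecLin)
  have hker : ∀ x, x ∈ LinearMap.ker (H * C).mulVecLin ↔ ∃ w ∈ W, C *ᵥ w = C *ᵥ x := by
    intro x
    rw [LinearMap.mem_ker, Matrix.mulVecLin_apply, ← Matrix.mulVec_mulVec, hH]
    simp [Submodule.mem_map]
  have hSspec := largestInvariant_spec (A₁ + -(A₁ * G) * C) (A₂ + -(A₂ * G) * C)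
    (LinearMap.ker (H * C).mulVecLin)
  refine ⟨invariantUnobservable (H * C) (A₁ + -(A₁ * G) * C) (A₂ + -(A₂ * G) * C),
    ⟨⟨_, _, _, _, rfl⟩, hKW.trans (hSspec.2 ⟨?_, ?_, ?_⟩)⟩, ?_⟩
  · exact fun x hx => (hker x).2 ⟨x, hx, rfl⟩
  · intro x hx
    rw [hexp]
    exact (hWc _ (hsub x hx) (hG x hx)).1
  · intro x hx
    rw [hexp]
    exact (hWc _ (hsub x hx) (hG x hx)).2
  · rintro T ⟨⟨D₁, D₂, h, H', rfl⟩, hKT⟩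
    set S := invariantUnobservable (H * C) (A₁ + -(A₁ * G) * C) (A₂ + -(A₂ * G) * C)
    set T := invariantUnobservable (H' * C) (A₁ + D₁ * C) (A₂ + D₂ * C)
    have hT := largestInvariant_spec (A₁ + D₁ * C) (A₂ + D₂ * C)
      (LinearMap.ker (H' * C).mulVecLin)
    have hzero : ∀ (A : Matrix (Fin n) (Fin n) ℝ) (D : Matrix (Fin n) (Fin q) ℝ)
        (x : Fin n → ℝ), C *ᵥ x = 0 → (A + D * C) *ᵥ x = A *ᵥ x := by
      intro A D x hx
      rw [Matrix.add_mulVec, ← Matrix.mulVec_mulVec, hx, Matrix.mulVec_zero, add_zero]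
    have hWT : W ≤ T := by
      refine sInf_le ⟨hKT, fun x hx hC => ⟨?_, ?_⟩⟩
      · rw [← hzero A₁ D₁ x hC]; exact hT.1.2.1 x hx
      · rw [← hzero A₂ D₂ x hC]; exact hT.1.2.2 x hx
    have hWS : W ≤ S := hSspec.2 ⟨fun x hx => (hker x).2 ⟨x, hx, rfl⟩,
      fun x hx => by rw [hexp]; exact (hWc _ (hsub x hx) (hG x hx)).1,
      fun x hx => by rw [hexp]; exact (hWc _ (hsub x hx) (hG x hx)).2⟩
    have hinv : ∀ (A : Matrix (Fin n) (Fin n) ℝ) (D D' : Matrix (Fin n) (Fin q) ℝ),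
        Invariant (A + D * C) T → Invariant (A + D' * C) S →
        Invariant (A + D * C) (S ⊔ T) := by
      intro A D D' h1 h2 x hx
      obtain ⟨s, hs, t, ht, rfl⟩ := Submodule.mem_sup.1 hx
      obtain ⟨w, hw, hCw⟩ := (hker s).1 (hSspec.1.1 hs)
      have hc : C *ᵥ (s - w) = 0 := by rw [Matrix.mulVec_sub, hCw, sub_self]
      have e : (A + D * C) *ᵥ (s + t) =
          (A + D' * C) *ᵥ (s - w) + (A + D * C) *ᵥ (w + t) := by
        rw [hzero A D' _ hc, ← hzero A D _ hc, ← Matrix.mulVec_add]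
        congr 1
        abel
      rw [e]
      exact Submodule.add_mem_sup (h2 _ (S.sub_mem hs (hWS hw)))
        (h1 _ (T.add_mem (hWT hw) ht))
    have hle : S ⊔ T ≤ T := by
      refine hT.2 ⟨sup_le ?_ hT.1.1, hinv A₁ D₁ _ hT.1.2.1 hSspec.1.2.1,
        hinv A₂ D₂ _ hT.1.2.2 hSspec.1.2.2⟩
      intro s hs
      obtain ⟨w, hw, hCw⟩ := (hker s).1 (hSspec.1.1 hs)
      have hw' := hT.1.1 (hWT hw)
      rw [LinearMap.mem_ker, Matrix.mulVecLin_apply, ← Matrix.mulVec_mulVec] at hw' ⊢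
      rw [← hCw]
      exact hw'
    exact le_sup_left.trans hle

/-! ### The Popov–Belevitch–Hautus matrix and its minimal left annihilator -/

/-- Real polynomials in the two indeterminates `z₁ = X 0`, `z₂ = X 1`. -/
abbrev Poly2 : Type := MvPolynomial (Fin 2) ℝ

/-- The PBH matrix `[I - z₁A₁ - z₂A₂ ; C]`. -/
def pbh {n q : ℕ} (A₁ A₂ : Matrix (Fin n) (Fin n) ℝ) (C : Matrix (Fin q) (Fin n) ℝ) :
    Matrix (Fin n ⊕ Fin q) (Fin n) Poly2 :=
  Matrix.fromRows
    (1 - (MvPolynomial.X 0 : Poly2) • A₁.map MvPolynomial.C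
      - (MvPolynomial.X 1 : Poly2) • A₂.map MvPolynomial.C)
    (C.map MvPolynomial.C)

/-- `N` is a minimal left annihilator of the polynomial matrix `G`: `N G = 0`, the rows of `N` are
linearly independent over the polynomial ring (full row rank), and every polynomial left
annihilator of `G` is a polynomial left multiple of `N`. -/
def IsMinimalLeftAnnihilator {ι κ : Type} [Fintype ι] {r : ℕ} (N : Matrix (Fin r) ι Poly2)
    (G : Matrix ι κ Poly2) : Prop :=
  N * G = 0 ∧ LinearIndependent Poly2 (fun i => N i) ∧
    ∀ (s : ℕ) (N' : Matrix (Fin s) ι Poly2), N' * G = 0 →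
      ∃ N₃ : Matrix (Fin s) (Fin r) Poly2, N' = N₃ * N

/-- The value of a polynomial matrix at the point `(z₁, z₂) ∈ ℂ²`. -/
def evalMatrix {ι κ : Type} (N : Matrix ι κ Poly2) (z₁ z₂ : ℂ) : Matrix ι κ ℂ :=
  N.map (MvPolynomial.aeval ![z₁, z₂])

/-- The Bisiacco–Valcher rank condition for the 2D system `(C, A₁, A₂)` with `p` faults whose
signatures are the columns of `L₁` and `L₂`: for a minimal left annihilator `N` of the PBH matrix,
`rank (N(z₁,z₂) [z₁L₁ + z₂L₂ ; 0]) = p` for all nonzero complex `z₁`, `z₂`. -/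
def BisiaccoValcherCondition {n q p : ℕ} (C : Matrix (Fin q) (Fin n) ℝ)
    (A₁ A₂ : Matrix (Fin n) (Fin n) ℝ) (L₁ L₂ : Matrix (Fin n) (Fin p) ℝ) : Prop :=
  ∃ (r : ℕ) (N : Matrix (Fin r) (Fin n ⊕ Fin q) Poly2),
    IsMinimalLeftAnnihilator N (pbh A₁ A₂ C) ∧
    ∀ z₁ z₂ : ℂ, z₁ ≠ 0 → z₂ ≠ 0 →
      (evalMatrix N z₁ z₂ *
        Matrix.fromRows (z₁ • L₁.map Complex.ofReal + z₂ • L₂.map Complex.ofReal)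
          (0 : Matrix (Fin q) (Fin p) ℂ)).rank = p

/-! ### The faulty 2D system and detection filters -/

/-- A Fornasini–Marchesini model II with state in `ℝⁿ`, input in `ℝᵐ`, output in `ℝ^q` and two
scalar faults; fault `k` acts through the signatures `L₁ k` and `L₂ k`. -/
structure FMII (n m q : ℕ) where
  A₁ : Matrix (Fin n) (Fin n) ℝ
  A₂ : Matrix (Fin n) (Fin n) ℝ
  B₁ : Matrix (Fin n) (Fin m) ℝ
  B₂ : Matrix (Fin n) (Fin m) ℝ
  C : Matrix (Fin q) (Fin n) ℝ
  L₁ : Fin 2 → Fin n → ℝ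
  L₂ : Fin 2 → Fin n → ℝ

/-- A detection filter (again of Fornasini–Marchesini type II) with state in `ℝᵒ`, driven by the
input `u` and the output `y`, and with the scalar residual `r = M ω - H y`. -/
structure DetectionFilter (m q : ℕ) where
  o : ℕ
  F₁ : Matrix (Fin o) (Fin o) ℝ
  F₂ : Matrix (Fin o) (Fin o) ℝ
  K₁ : Matrix (Fin o) (Fin m) ℝ
  K₂ : Matrix (Fin o) (Fin m) ℝ
  E₁ : Matrix (Fin o) (Fin q) ℝ
  E₂ : Matrix (Fin o) (Fin q) ℝ
  M : Fin o → ℝ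
  H : Fin q → ℝ

namespace FMII

variable {n m q : ℕ}

/-- `(x, u, f, y)` satisfies the system equations on the half plane `i + j ≥ 0`; the initial
condition is the (arbitrary) restriction of `x` to the separation set `i + j = 0`. -/
def IsTrajectory (S : FMII n m q) (x : ℤ → ℤ → Fin n → ℝ) (u : ℤ → ℤ → Fin m → ℝ)
    (f : Fin 2 → ℤ → ℤ → ℝ) (y : ℤ → ℤ → Fin q → ℝ) : Prop :=
  (∀ i j : ℤ, 0 ≤ i + j + 1 →
    x (i + 1) (j + 1) = S.A₁ *ᵥ x i (j + 1) + S.A₂ *ᵥ x (i + 1) j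
      + S.B₁ *ᵥ u i (j + 1) + S.B₂ *ᵥ u (i + 1) j
      + ∑ k, f k i (j + 1) • S.L₁ k + ∑ k, f k (i + 1) j • S.L₂ k) ∧
  ∀ i j : ℤ, 0 ≤ i + j → y i j = S.C *ᵥ x i j

/-- The subspace spanned by the two signatures of fault `k`. -/
def faultSpace (S : FMII n m q) (k : Fin 2) : Submodule ℝ (Fin n → ℝ) :=
  Submodule.span ℝ {S.L₁ k} ⊔ Submodule.span ℝ {S.L₂ k}

/-- The smallest unobservability subspace containing the signatures of the fault other than `k`
(in `Fin 2` the other fault is `1 - k`). -/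
def sStar (S : FMII n m q) (k : Fin 2) : Submodule ℝ (Fin n → ℝ) :=
  smallestUnobservability S.C S.A₁ S.A₂ (S.faultSpace (1 - k))

/-- The geometric condition: the signatures of fault `k` do not all lie in the smallest
unobservability subspace containing the signatures of the other fault. -/
def GeometricCondition (S : FMII n m q) (k : Fin 2) : Prop :=
  ¬ S.faultSpace k ≤ S.sStar k

/-- A quotient subsystem `(M, A₁ᵖ, A₂ᵖ)` obtained by factoring out `S*`. The canonical projection
`ℝⁿ → ℝⁿ / S*` is represented, in coordinates of the quotient, by a surjective matrix `P` with
kernel `S*`. -/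
structure QuotientSubsystem (S : FMII n m q) (k : Fin 2) (d h : ℕ) where
  P : Matrix (Fin d) (Fin n) ℝ
  D₁ : Matrix (Fin n) (Fin q) ℝ
  D₂ : Matrix (Fin n) (Fin q) ℝ
  H : Matrix (Fin h) (Fin q) ℝ
  Ap₁ : Matrix (Fin d) (Fin d) ℝ
  Ap₂ : Matrix (Fin d) (Fin d) ℝ
  M : Matrix (Fin h) (Fin d) ℝ
  surjective_P : Function.Surjective P.mulVecLin
  ker_P : LinearMap.ker P.mulVecLin = S.sStar k
  Ap₁_mul : Ap₁ * P = P * (S.A₁ + D₁ * S.C)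
  Ap₂_mul : Ap₂ * P = P * (S.A₂ + D₂ * S.C)
  ker_HC : LinearMap.ker (H * S.C).mulVecLin = S.sStar k ⊔ LinearMap.ker S.C.mulVecLin
  M_mul : M * P = H * S.C

/-- The Bisiacco–Valcher condition for the quotient subsystem, whose only fault is fault `k`, with
the signatures `P L₁ k` and `P L₂ k`. -/
def QuotientSubsystem.RankCondition {S : FMII n m q} {k : Fin 2} {d h : ℕ}
    (Qs : S.QuotientSubsystem k d h) : Prop :=
  BisiaccoValcherCondition Qs.M Qs.Ap₁ Qs.Ap₂
    (Matrix.replicateCol (Fin 1) (Qs.P *ᵥ S.L₁ k))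
    (Matrix.replicateCol (Fin 1) (Qs.P *ᵥ S.L₂ k))

/-- Fault `k` is detectable and isolable: after some output injection and output mixing, the
signatures of the other fault are in the invariant unobservable subspace, those of fault `k` are
not. -/
def DetectableIsolable (S : FMII n m q) (k : Fin 2) : Prop :=
  ∃ (D₁ D₂ : Matrix (Fin n) (Fin q) ℝ) (h : ℕ) (H : Matrix (Fin h) (Fin q) ℝ),
    S.faultSpace (1 - k) ≤
        invariantUnobservable (H * S.C) (S.A₁ + D₁ * S.C) (S.A₂ + D₂ * S.C) ∧
      ¬ S.faultSpace k ≤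
        invariantUnobservable (H * S.C) (S.A₁ + D₁ * S.C) (S.A₂ + D₂ * S.C)

end FMII

namespace DetectionFilter

variable {n m q : ℕ}

/-- `ω` is a state evolution of the filter on the half plane `i + j ≥ 0` for the signals `u`, `y`,
with arbitrary initial values on `i + j = 0`. -/
def IsStateEvolution (Φ : DetectionFilter m q) (ω : ℤ → ℤ → Fin Φ.o → ℝ)
    (u : ℤ → ℤ → Fin m → ℝ) (y : ℤ → ℤ → Fin q → ℝ) : Prop :=
  ∀ i j : ℤ, 0 ≤ i + j + 1 →
    ω (i + 1) (j + 1) = Φ.F₁ *ᵥ ω i (j + 1) + Φ.F₂ *ᵥ ω (i + 1) j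
      + Φ.K₁ *ᵥ u i (j + 1) + Φ.K₂ *ᵥ u (i + 1) j
      + Φ.E₁ *ᵥ y i (j + 1) + Φ.E₂ *ᵥ y (i + 1) j

/-- The residual signal `r(i,j) = M ω(i,j) - H y(i,j)`. -/
def residual (Φ : DetectionFilter m q) (ω : ℤ → ℤ → Fin Φ.o → ℝ)
    (y : ℤ → ℤ → Fin q → ℝ) (i j : ℤ) : ℝ :=
  Φ.M ⬝ᵥ ω i j - Φ.H ⬝ᵥ y i j

/-- The joint behaviour of the faulty system and the filter. -/
def IsRun (Φ : DetectionFilter m q) (S : FMII n m q) (x : ℤ → ℤ → Fin n → ℝ)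
    (u : ℤ → ℤ → Fin m → ℝ) (f : Fin 2 → ℤ → ℤ → ℝ) (y : ℤ → ℤ → Fin q → ℝ)
    (ω : ℤ → ℤ → Fin Φ.o → ℝ) : Prop :=
  S.IsTrajectory x u f y ∧ Φ.IsStateEvolution ω u y

/-- The filter reconstructs fault `k` up to the delay `(n₁, n₂) ≠ (0, 0)`: for all initial
conditions of system and filter, all inputs and all faults, `r(i,j) = f_k(i - n₁, j - n₂)` as soon
as `i + j > N₀`. -/
def IsDelayedDeadbeat (Φ : DetectionFilter m q) (S : FMII n m q) (k : Fin 2) : Prop :=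
  ∃ (n₁ n₂ N₀ : ℕ), 0 < n₁ + n₂ ∧ n₁ + n₂ ≤ N₀ ∧
    ∀ x u f y ω, Φ.IsRun S x u f y ω →
      ∀ i j : ℤ, (N₀ : ℤ) < i + j → Φ.residual ω y i j = f k (i - n₁) (j - n₂)

/-- The filter generates a residual for fault `k`, decoupled from the input and the other fault:
* if fault `k` vanishes, then `r(i,j) → 0` as `i + j → ∞`;
* a fault `k` that is nonzero somewhere after the transient (`i + j > N₀`) makes `r` nonzero;
* if system and filter start at rest, every nonzero fault `k` makes `r` nonzero. -/
def IsResidualGenerator (Φ : DetectionFilter m q) (S : FMII n m q) (k : Fin 2) : Prop :=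
  (∀ x u f y ω, Φ.IsRun S x u f y ω → (∀ i j : ℤ, 0 ≤ i + j → f k i j = 0) →
    Tendsto (fun p : ℤ × ℤ => Φ.residual ω y p.1 p.2)
      (comap (fun p : ℤ × ℤ => p.1 + p.2) atTop) (𝓝 0)) ∧
  (∃ N₀ : ℕ, ∀ x u f y ω, Φ.IsRun S x u f y ω →
    (∃ i j : ℤ, (N₀ : ℤ) < i + j ∧ f k i j ≠ 0) →
      ∃ i j : ℤ, 0 ≤ i + j ∧ Φ.residual ω y i j ≠ 0) ∧
  (∀ x u f y ω, Φ.IsRun S x u f y ω →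
    (∀ i j : ℤ, i + j = 0 → x i j = 0 ∧ ω i j = 0) →
    (∃ i j : ℤ, 0 ≤ i + j ∧ f k i j ≠ 0) →
      ∃ i j : ℤ, 0 ≤ i + j ∧ Φ.residual ω y i j ≠ 0)

end DetectionFilter

/-- The FDI problem is solved for fault `k` by a delayed deadbeat filter: the fault is detectable
and isolable, and some filter is a residual generator for it that reconstructs it up to a delay. -/
def FMII.SolvableFor {n m q : ℕ} (S : FMII n m q) (k : Fin 2) : Prop :=
  S.DetectableIsolable k ∧
    ∃ Φ : DetectionFilter m q, Φ.IsResidualGenerator S k ∧ Φ.IsDelayedDeadbeat S k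

/-- The FDI problem is solved by delayed deadbeat filters, one for each of the two faults. -/
def FMII.Solvable {n m q : ℕ} (S : FMII n m q) : Prop :=
  ∀ k : Fin 2, S.SolvableFor k

end TwoDFDI

end

noncomputable section

namespace TwoDFDI

/-! ### Polynomials in the delay operators -/

/-! Read `z₁` and `z₂` as unit delays, so that polynomials act on signals over `ℤ × ℤ`. The
projection `P` has kernel `S*`, which contains the signatures of the other fault; hence `z = P x`
satisfies a quotient equation driven only by `u`, `y` and `f_k`, namely `(I - z₁A₁ᵖ - z₂A₂ᵖ) z =
(known terms) + (z₁PL₁ + z₂PL₂) f_k`, with `M z = H y`.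

The rank condition says that the entries of `N [z₁PL₁ + z₂PL₂ ; 0]` have no common zero with both
coordinates nonzero. By the Nullstellensatz a polynomial combination of them equals `(z₁z₂)^e`
(`exists_sum_mul_eq_monomial`). The same combination of the rows of `N` is a row `(x, y)` that
annihilates the PBH matrix. Applied to the quotient equations it removes the state and leaves
`f_k(i-e, j-e)` as a polynomial in the delays of `u` and `y` (`exists_fault_reconstruction`).

Such a polynomial needs finitely many past samples, which a shift register stores and reads out
(`DetectionFilter.exists_realization`). Its initial content leaves after finitely many steps, so
reconstruction is exact after a transient whatever the initial values. All estimates are uniform in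
the starting time `T`. For runs starting at rest, extension by zero permits an arbitrarily early
`T`, so the transient disappears; this gives the last residual property. -/

/-- The value at `(i, j)` of the signal obtained from `g` by the polynomial `p` in the delays
`z₁ g (i, j) = g (i - 1, j)` and `z₂ g (i, j) = g (i, j - 1)`. -/
def delayEval (g : ℤ → ℤ → ℝ) (i j : ℤ) : Poly2 →ₗ[ℝ] ℝ :=
  (MvPolynomial.basisMonomials (Fin 2) ℝ).constr ℝ fun s => g (i - s 0) (j - s 1)

theorem delayEval_monomial (g : ℤ → ℤ → ℝ) (i j : ℤ) (s : Fin 2 →₀ ℕ) (c : ℝ) :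
    delayEval g i j (MvPolynomial.monomial s c) = c * g (i - s 0) (j - s 1) := by
  have h := (MvPolynomial.basisMonomials (Fin 2) ℝ).constr_basis ℝ
    (fun s => g (i - s 0) (j - s 1)) s
  rw [MvPolynomial.coe_basisMonomials] at h
  have e : MvPolynomial.monomial s c = c • (MvPolynomial.monomial s (1 : ℝ)) := by
    rw [MvPolynomial.smul_monomial, smul_eq_mul, mul_one]
  rw [e, map_smul, smul_eq_mul, delayEval, h]

theorem delayEval_eq_sum (g : ℤ → ℤ → ℝ) (i j : ℤ) (p : Poly2) :
    delayEval g i j p = ∑ s ∈ p.support, p.coeff s * g (i - s 0) (j - s 1) := by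
  conv_lhs => rw [p.as_sum]
  rw [map_sum]
  exact Finset.sum_congr rfl fun s _ => delayEval_monomial g i j s _

/-- Multiplication in the polynomial ring becomes a shift of the evaluation point. This is what lets
polynomial identities be transferred to signals. -/
theorem delayEval_X_mul (g : ℤ → ℤ → ℝ) (i j : ℤ) (k : Fin 2) (p : Poly2) :
    delayEval g i j (MvPolynomial.X k * p) =
      delayEval g (i - if k = 0 then 1 else 0) (j - if k = 1 then 1 else 0) p := by
  induction p using MvPolynomial.induction_on' with
  | monomial s c =>
    rw [MvPolynomial.X, MvPolynomial.monomial_mul, one_mul, delayEval_monomial, delayEval_monomial]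
    congr 2 <;> fin_cases k <;> simp <;> ring
  | add p q hp hq => rw [mul_add, map_add, map_add, hp, hq]

theorem delayEval_C_mul (g : ℤ → ℤ → ℝ) (i j : ℤ) (c : ℝ) (p : Poly2) :
    delayEval g i j (MvPolynomial.C c * p) = c * delayEval g i j p := by
  rw [MvPolynomial.C_mul', map_smul, smul_eq_mul]

theorem delayEval_sum_mul {ι : Type} [Fintype ι] (c : ι → ℝ) (g : ι → ℤ → ℤ → ℝ) (i j : ℤ)
    (p : Poly2) :
    delayEval (fun i j => ∑ a, c a * g a i j) i j p = ∑ a, c a * delayEval (g a) i j p := by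
  simp only [delayEval_eq_sum, Finset.mul_sum]
  rw [Finset.sum_comm]
  exact Finset.sum_congr rfl fun a _ => Finset.sum_congr rfl fun s _ => by ring

/-- The signal obtained from the vector signal `g` by a polynomial row vector in the delays. -/
def rowEval {ι : Type} [Fintype ι] (g : ℤ → ℤ → ι → ℝ) (i j : ℤ) : (ι → Poly2) →ₗ[ℝ] ℝ :=
  ∑ a, delayEval (fun i j => g i j a) i j ∘ₗ LinearMap.proj a

section RowEval

variable {ι κ : Type} [Fintype ι] [Fintype κ]

theorem rowEval_apply (g : ℤ → ℤ → ι → ℝ) (i j : ℤ) (p : ι → Poly2) :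
    rowEval g i j p = ∑ a, delayEval (fun i j => g i j a) i j (p a) := by
  simp [rowEval]

/-- Constant matrices commute with delays, so a matrix may be moved from the polynomial row to the
signal. -/
theorem rowEval_vecMul (g : ℤ → ℤ → κ → ℝ) (i j : ℤ) (p : ι → Poly2) (A : Matrix ι κ ℝ) :
    rowEval g i j (p ᵥ* A.map MvPolynomial.C) = rowEval (fun i j => A *ᵥ g i j) i j p := by
  simp only [rowEval_apply, Matrix.vecMul, Matrix.mulVec, dotProduct, Matrix.map_apply, map_sum,
    delayEval_sum_mul]
  rw [Finset.sum_comm]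
  refine Finset.sum_congr rfl fun a _ => Finset.sum_congr rfl fun b _ => ?_
  rw [mul_comm, delayEval_C_mul]

theorem rowEval_X_zero_smul (g : ℤ → ℤ → ι → ℝ) (i j : ℤ) (p : ι → Poly2) :
    rowEval g i j ((MvPolynomial.X 0 : Poly2) • p) = rowEval g (i - 1) j p := by
  simp [rowEval_apply, delayEval_X_mul]

theorem rowEval_X_one_smul (g : ℤ → ℤ → ι → ℝ) (i j : ℤ) (p : ι → Poly2) :
    rowEval g i j ((MvPolynomial.X 1 : Poly2) • p) = rowEval g i (j - 1) p := by
  simp [rowEval_apply, delayEval_X_mul]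

theorem rowEval_shift (g : ℤ → ℤ → ι → ℝ) (i j a b : ℤ) (p : ι → Poly2) :
    rowEval (fun i j => g (i - a) (j - b)) i j p = rowEval g (i - a) (j - b) p := by
  simp only [rowEval_apply, delayEval_eq_sum]
  refine Finset.sum_congr rfl fun a _ => Finset.sum_congr rfl fun b _ => ?_
  rw [sub_right_comm, sub_right_comm j]

theorem rowEval_add_signal (g g' : ℤ → ℤ → ι → ℝ) (i j : ℤ) (p : ι → Poly2) :
    rowEval (fun i j => g i j + g' i j) i j p = rowEval g i j p + rowEval g' i j p := by
  simp only [rowEval_apply, delayEval_eq_sum, Pi.add_apply, mul_add, Finset.sum_add_distrib]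

/-- A signal with fixed direction `l` sees only the scalar polynomial `p · l`; this is how the fault
signature enters the polynomial identity. -/
theorem rowEval_smul_signal (f : ℤ → ℤ → ℝ) (l : ι → ℝ) (i j : ℤ) (p : ι → Poly2) :
    rowEval (fun i j => f i j • l) i j p = delayEval f i j (∑ a, p a * MvPolynomial.C (l a)) := by
  rw [rowEval_apply, map_sum]
  refine Finset.sum_congr rfl fun a _ => ?_
  rw [mul_comm, delayEval_C_mul, delayEval_eq_sum, delayEval_eq_sum, Finset.mul_sum]
  exact Finset.sum_congr rfl fun s _ => by simp only [Pi.smul_apply, smul_eq_mul]; ring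

/-- A polynomial in the delays only looks finitely far into the past. -/
theorem exists_rowEval_congr (p : ι → Poly2) :
    ∃ N : ℕ, ∀ (g g' : ℤ → ℤ → ι → ℝ) (T i j : ℤ), T + N ≤ i + j →
      (∀ i' j' : ℤ, T ≤ i' + j' → g i' j' = g' i' j') → rowEval g i j p = rowEval g' i j p := by
  -- Any bound for the total degrees of the entries of `p` would do; the sum over all monomials is a
  -- crude one.
  refine ⟨∑ a, ∑ s ∈ (p a).support, (s 0 + s 1), fun g g' T i j hT h => ?_⟩
  simp only [rowEval_apply, delayEval_eq_sum]
  refine Finset.sum_congr rfl fun a _ => Finset.sum_congr rfl fun s hs => ?_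
  have h1 : s 0 + s 1 ≤ ∑ s ∈ (p a).support, (s 0 + s 1) :=
    Finset.single_le_sum (f := fun s : Fin 2 →₀ ℕ => s 0 + s 1) (fun _ _ => Nat.zero_le _) hs
  have h2 : ∑ s ∈ (p a).support, (s 0 + s 1) ≤ ∑ a, ∑ s ∈ (p a).support, (s 0 + s 1) :=
    Finset.single_le_sum (f := fun a => ∑ s ∈ (p a).support, (s 0 + s 1))
      (fun _ _ => Nat.zero_le _) (Finset.mem_univ a)
  rw [h _ _ (by lia)]

end RowEval

/-! ### Consequences of the Nullstellensatz -/

/-- Real polynomials without a common zero in `(ℂ \ {0})²` generate a monomial. -/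
theorem exists_sum_mul_eq_monomial {r : ℕ} (v : Fin r → Poly2)
    (hv : ∀ z₁ z₂ : ℂ, z₁ ≠ 0 → z₂ ≠ 0 → ∃ i, MvPolynomial.aeval ![z₁, z₂] (v i) ≠ 0) :
    ∃ (e : ℕ) (a : Fin r → Poly2),
      ∑ i, a i * v i = MvPolynomial.X 0 ^ e * MvPolynomial.X 1 ^ e := by
  have h : (MvPolynomial.X 0 * MvPolynomial.X 1 : Poly2) ∈ (Ideal.span (Set.range v)).radical := by
    -- The ideal lives over `ℝ` but its zeros are tested over `ℂ`, so the resulting combination has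
    -- real coefficients and can be realized by a real filter.
    rw [← MvPolynomial.vanishingIdeal_zeroLocus_eq_radical (K := ℂ),
      MvPolynomial.mem_vanishingIdeal_iff]
    intro x hx
    rw [MvPolynomial.mem_zeroLocus_iff] at hx
    by_contra hne
    rw [map_mul, MvPolynomial.aeval_X, MvPolynomial.aeval_X, mul_eq_zero, not_or] at hne
    obtain ⟨i, hi⟩ := hv _ _ hne.1 hne.2
    have e : ![x 0, x 1] = x := by ext i; fin_cases i <;> rfl
    rw [e] at hi
    exact hi (hx _ (Ideal.subset_span ⟨i, rfl⟩))
  obtain ⟨e, he⟩ := h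
  obtain ⟨a, ha⟩ := (Ideal.mem_span_range_iff_exists_fun).1 he
  exact ⟨e, a, by rw [ha, mul_pow]⟩

/-- Under the Bisiacco–Valcher condition for one fault, a polynomial left annihilator of the PBH
matrix turns the fault signature into a monomial. -/
theorem BisiaccoValcherCondition.exists_annihilator {n q : ℕ} {C : Matrix (Fin q) (Fin n) ℝ}
    {A₁ A₂ : Matrix (Fin n) (Fin n) ℝ} {l₁ l₂ : Fin n → ℝ}
    (hBV : BisiaccoValcherCondition C A₁ A₂ (Matrix.replicateCol (Fin 1) l₁)
      (Matrix.replicateCol (Fin 1) l₂)) :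
    ∃ (e : ℕ) (x : Fin n → Poly2) (y : Fin q → Poly2),
      x ᵥ* (1 - (MvPolynomial.X 0 : Poly2) • A₁.map MvPolynomial.C
        - (MvPolynomial.X 1 : Poly2) • A₂.map MvPolynomial.C) + y ᵥ* C.map MvPolynomial.C = 0 ∧
      ∑ a, x a * (MvPolynomial.X 0 * MvPolynomial.C (l₁ a) +
        MvPolynomial.X 1 * MvPolynomial.C (l₂ a)) =
          MvPolynomial.X 0 ^ e * MvPolynomial.X 1 ^ e := by
  obtain ⟨r, N, ⟨hN, -, -⟩, hrank⟩ := hBV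
  obtain ⟨e, a, ha⟩ := exists_sum_mul_eq_monomial
    (fun i => ∑ b, N i (Sum.inl b) * (MvPolynomial.X 0 * MvPolynomial.C (l₁ b) +
        MvPolynomial.X 1 * MvPolynomial.C (l₂ b))) (by
    intro z₁ z₂ h₁ h₂
    -- If every entry vanished at `(z₁, z₂)`, the whole column would be zero and its rank would be 0
    -- instead of 1.
    by_contra! hcon
    have := hrank z₁ z₂ h₁ h₂
    rw [show evalMatrix N z₁ z₂ * Matrix.fromRows
        (z₁ • (Matrix.replicateCol (Fin 1) l₁).map Complex.ofReal +
          z₂ • (Matrix.replicateCol (Fin 1) l₂).map Complex.ofReal)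
          (0 : Matrix (Fin q) (Fin 1) ℂ) = 0 from ?_, Matrix.rank_zero] at this
    · exact zero_ne_one this
    · ext i j
      rw [Matrix.zero_apply, ← hcon i]
      simp [Matrix.mul_apply, evalMatrix])
  refine ⟨e, fun b => (a ᵥ* N) (Sum.inl b), fun b => (a ᵥ* N) (Sum.inr b), ?_, ?_⟩
  · have h0 : (a ᵥ* N) ᵥ* pbh A₁ A₂ C = 0 := by rw [Matrix.vecMul_vecMul, hN, Matrix.vecMul_zero]
    rw [pbh, Matrix.vecMul_fromRows] at h0
    exact h0
  · rw [← ha]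
    simp only [Matrix.vecMul, dotProduct, Finset.sum_mul, Finset.mul_sum]
    rw [Finset.sum_comm]
    exact Finset.sum_congr rfl fun i _ => Finset.sum_congr rfl fun b _ => by ring


/-! ### Reconstruction of the fault from finitely many past inputs and outputs -/

/-- If `(x, y)` annihilates the PBH matrix and turns the fault signature into `(z₁ z₂)ᵉ`, then the
fault delayed by `(e, e)` is a polynomial in the delays of the known signals. -/
theorem exists_fault_reconstruction {d h : ℕ} {σ : Type} [Fintype σ]
    {A₁ A₂ : Matrix (Fin d) (Fin d) ℝ} {M : Matrix (Fin h) (Fin d) ℝ}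
    (G₁ G₂ : Matrix (Fin d) σ ℝ) (H : Matrix (Fin h) σ ℝ) {l₁ l₂ : Fin d → ℝ} {e : ℕ}
    {x : Fin d → Poly2} {y : Fin h → Poly2}
    (hxy : x ᵥ* (1 - (MvPolynomial.X 0 : Poly2) • A₁.map MvPolynomial.C
      - (MvPolynomial.X 1 : Poly2) • A₂.map MvPolynomial.C) + y ᵥ* M.map MvPolynomial.C = 0)
    (hl : ∑ a, x a * (MvPolynomial.X 0 * MvPolynomial.C (l₁ a) +
      MvPolynomial.X 1 * MvPolynomial.C (l₂ a)) = MvPolynomial.X 0 ^ e * MvPolynomial.X 1 ^ e) :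
    ∃ (N : ℕ) (p : σ → Poly2), ∀ (T : ℤ) (z : ℤ → ℤ → Fin d → ℝ) (w : ℤ → ℤ → σ → ℝ)
      (f : ℤ → ℤ → ℝ),
      (∀ i j : ℤ, T ≤ i + j + 1 → z (i + 1) (j + 1) = A₁ *ᵥ z i (j + 1) + A₂ *ᵥ z (i + 1) j
        + G₁ *ᵥ w i (j + 1) + G₂ *ᵥ w (i + 1) j + f i (j + 1) • l₁ + f (i + 1) j • l₂) →
      (∀ i j : ℤ, T ≤ i + j → M *ᵥ z i j = H *ᵥ w i j) →
      ∀ i j : ℤ, T + N < i + j → rowEval w i j p = f (i - e) (j - e) := by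
  obtain ⟨N₁, hN₁⟩ := exists_rowEval_congr x
  obtain ⟨N₂, hN₂⟩ := exists_rowEval_congr y
  -- Add `x` times the state equation and `y` times the output equation: the terms in `z` cancel by
  -- `hxy`, and solving for `(z₁z₂)^e f` gives this row.
  refine ⟨N₁ + N₂, -(y ᵥ* H.map MvPolynomial.C
    + (MvPolynomial.X 0 : Poly2) • (x ᵥ* G₁.map MvPolynomial.C)
    + (MvPolynomial.X 1 : Poly2) • (x ᵥ* G₂.map MvPolynomial.C)), ?_⟩
  intro T z w f hz hM i j hij
  have hshift₁ : ∀ {ι : Type} [Fintype ι] (g : ℤ → ℤ → ι → ℝ) (p : ι → Poly2),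
      rowEval (fun i j => g (i - 1) j) i j p = rowEval g (i - 1) j p := fun g p => by
    simpa using rowEval_shift g i j 1 0 p
  have hshift₂ : ∀ {ι : Type} [Fintype ι] (g : ℤ → ℤ → ι → ℝ) (p : ι → Poly2),
      rowEval (fun i j => g i (j - 1)) i j p = rowEval g i (j - 1) p := fun g p => by
    simpa using rowEval_shift g i j 0 1 p
  -- The state equation determines `z` only on `i + j ≥ T + 1`, hence the start at `T + 1`.
  have hstate := hN₁ z (fun i j => A₁ *ᵥ z (i - 1) j + A₂ *ᵥ z i (j - 1)
    + G₁ *ᵥ w (i - 1) j + G₂ *ᵥ w i (j - 1) + f (i - 1) j • l₁ + f i (j - 1) • l₂)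
    (T + 1) i j (by push_cast at hij; lia) (fun i' j' h' => by
      have := hz (i' - 1) (j' - 1) (by lia)
      simpa using this)
  simp only [rowEval_add_signal] at hstate
  rw [hshift₁ (fun i j => A₁ *ᵥ z i j), hshift₂ (fun i j => A₂ *ᵥ z i j),
    hshift₁ (fun i j => G₁ *ᵥ w i j), hshift₂ (fun i j => G₂ *ᵥ w i j),
    hshift₁ (fun i j => f i j • l₁), hshift₂ (fun i j => f i j • l₂),
    rowEval_smul_signal, rowEval_smul_signal] at hstate
  have hout := hN₂ (fun i j => M *ᵥ z i j) (fun i j => H *ᵥ w i j) T i j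
    (by push_cast at hij; lia) hM
  have hann := congrArg (rowEval z i j) hxy
  rw [Matrix.vecMul_sub, Matrix.vecMul_sub, Matrix.vecMul_one, Matrix.vecMul_smul,
    Matrix.vecMul_smul, map_add, map_sub, map_sub, map_zero, rowEval_X_zero_smul,
    rowEval_X_one_smul, rowEval_vecMul, rowEval_vecMul, rowEval_vecMul] at hann
  have hfault := congrArg (delayEval f i j) hl
  have hsplit : ∑ a, x a * (MvPolynomial.X 0 * MvPolynomial.C (l₁ a) +
      MvPolynomial.X 1 * MvPolynomial.C (l₂ a)) =
      MvPolynomial.X 0 * ∑ a, x a * MvPolynomial.C (l₁ a) +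
      MvPolynomial.X 1 * ∑ a, x a * MvPolynomial.C (l₂ a) := by
    rw [Finset.mul_sum, Finset.mul_sum, ← Finset.sum_add_distrib]
    exact Finset.sum_congr rfl fun a _ => by ring
  have hmono : (MvPolynomial.X 0 ^ e * MvPolynomial.X 1 ^ e : Poly2) =
      MvPolynomial.monomial (Finsupp.single 0 e + Finsupp.single 1 e) 1 := by
    rw [MvPolynomial.X_pow_eq_monomial, MvPolynomial.X_pow_eq_monomial,
      MvPolynomial.monomial_mul, one_mul]
  rw [hsplit, map_add, delayEval_X_mul, delayEval_X_mul, hmono, delayEval_monomial] at hfault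
  simp only [one_ne_zero, zero_ne_one, if_true, if_false, sub_zero, Finsupp.add_apply,
    Finsupp.single_apply, add_zero, zero_add, one_mul] at hfault
  rw [map_neg, map_add, map_add, rowEval_X_zero_smul, rowEval_X_one_smul, rowEval_vecMul,
    rowEval_vecMul, rowEval_vecMul]
  linarith

/-! ### Decoupling from the other fault in the quotient by `S*` -/

namespace FMII

variable {n m q : ℕ}

/-- The system equations on the half plane `i + j ≥ T`. -/
def IsTrajectoryFrom (S : FMII n m q) (T : ℤ) (x : ℤ → ℤ → Fin n → ℝ) (u : ℤ → ℤ → Fin m → ℝ)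
    (f : Fin 2 → ℤ → ℤ → ℝ) (y : ℤ → ℤ → Fin q → ℝ) : Prop :=
  (∀ i j : ℤ, T ≤ i + j + 1 →
    x (i + 1) (j + 1) = S.A₁ *ᵥ x i (j + 1) + S.A₂ *ᵥ x (i + 1) j
      + S.B₁ *ᵥ u i (j + 1) + S.B₂ *ᵥ u (i + 1) j
      + ∑ k, f k i (j + 1) • S.L₁ k + ∑ k, f k (i + 1) j • S.L₂ k) ∧
  ∀ i j : ℤ, T ≤ i + j → y i j = S.C *ᵥ x i j

theorem faultSpace_le_sStar (S : FMII n m q) (k : Fin 2) : S.faultSpace (1 - k) ≤ S.sStar k :=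
  (isLeast_smallestUnobservability S.C S.A₁ S.A₂ (S.faultSpace (1 - k))).1.2

/-- `S*` is itself an unobservability subspace, so the maps that present it as one are the required
witnesses. -/
theorem GeometricCondition.detectableIsolable {S : FMII n m q} {k : Fin 2}
    (hk : S.GeometricCondition k) : S.DetectableIsolable k := by
  obtain ⟨D₁, D₂, h, H, hV⟩ :=
    (isLeast_smallestUnobservability S.C S.A₁ S.A₂ (S.faultSpace (1 - k))).1.1
  refine ⟨D₁, D₂, h, H, ?_, ?_⟩
  · rw [← hV]
    exact S.faultSpace_le_sStar k
  · rw [← hV]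
    exact hk

namespace QuotientSubsystem

variable {S : FMII n m q} {k : Fin 2} {d h : ℕ}

/-- The projection onto the quotient annihilates the other fault. -/
theorem mulVec_sum_faults (Qs : S.QuotientSubsystem k d h) (c : Fin 2 → ℝ)
    (L : Fin 2 → Fin n → ℝ) (hL : L (1 - k) ∈ S.faultSpace (1 - k)) :
    Qs.P *ᵥ ∑ k', c k' • L k' = c k • Qs.P *ᵥ L k := by
  have h0 : Qs.P *ᵥ L (1 - k) = 0 := by
    have : L (1 - k) ∈ LinearMap.ker Qs.P.mulVecLin := by
      rw [Qs.ker_P]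
      exact S.faultSpace_le_sStar k hL
    exact this
  have hsum : ∑ k', c k' • L k' = c k • L k + c (1 - k) • L (1 - k) := by
    fin_cases k
    · simp [Fin.sum_univ_two]
    · simp [Fin.sum_univ_two, add_comm]
  rw [hsum, Matrix.mulVec_add, Matrix.mulVec_smul, Matrix.mulVec_smul, h0, smul_zero, add_zero]

/-- The fault is, up to a delay, a polynomial in the delays of input and output. -/
theorem RankCondition.exists_reconstruction {Qs : S.QuotientSubsystem k d h}
    (hQ : Qs.RankCondition) :
    ∃ (e N : ℕ) (p : Fin m ⊕ Fin q → Poly2), ∀ (T : ℤ) (x u f y), S.IsTrajectoryFrom T x u f y →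
      ∀ i j : ℤ, T + N < i + j →
        rowEval (fun i j => Sum.elim (u i j) (y i j)) i j p = f k (i - e) (j - e) := by
  obtain ⟨e, X, Y, hXY, hl⟩ := BisiaccoValcherCondition.exists_annihilator hQ
  -- Since `P Aᵢ x = Aᵢᵖ P x - P Dᵢ C x`, the output acts on the quotient as an extra input with
  -- coefficient `-P Dᵢ`.
  obtain ⟨N, p, hp⟩ := exists_fault_reconstruction
    (Matrix.fromCols (Qs.P * S.B₁) (-(Qs.P * Qs.D₁)))
    (Matrix.fromCols (Qs.P * S.B₂) (-(Qs.P * Qs.D₂))) (Matrix.fromCols 0 Qs.H) hXY hl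
  refine ⟨e, N, p, fun T x u f y ⟨hx, hy⟩ => hp T (fun i j => Qs.P *ᵥ x i j) _ (f k) ?_ ?_⟩
  · intro i j hij
    have e₁ : ∀ v, Qs.Ap₁ *ᵥ Qs.P *ᵥ v = Qs.P *ᵥ S.A₁ *ᵥ v + (Qs.P * Qs.D₁) *ᵥ S.C *ᵥ v := by
      intro v
      rw [Matrix.mulVec_mulVec, Qs.Ap₁_mul, ← Matrix.mulVec_mulVec, Matrix.add_mulVec,
        Matrix.mulVec_add, ← Matrix.mulVec_mulVec, ← Matrix.mulVec_mulVec]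
    have e₂ : ∀ v, Qs.Ap₂ *ᵥ Qs.P *ᵥ v = Qs.P *ᵥ S.A₂ *ᵥ v + (Qs.P * Qs.D₂) *ᵥ S.C *ᵥ v := by
      intro v
      rw [Matrix.mulVec_mulVec, Qs.Ap₂_mul, ← Matrix.mulVec_mulVec, Matrix.add_mulVec,
        Matrix.mulVec_add, ← Matrix.mulVec_mulVec, ← Matrix.mulVec_mulVec]
    have hL₁ : S.L₁ (1 - k) ∈ S.faultSpace (1 - k) :=
      Submodule.mem_sup_left (Submodule.mem_span_singleton_self _)
    have hL₂ : S.L₂ (1 - k) ∈ S.faultSpace (1 - k) :=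
      Submodule.mem_sup_right (Submodule.mem_span_singleton_self _)
    rw [hx i j hij]
    simp only [Matrix.mulVec_add, Matrix.fromCols_mulVec_sumElim, e₁, e₂, Matrix.neg_mulVec,
      hy i (j + 1) (by lia), hy (i + 1) j (by lia)]
    rw [Qs.mulVec_sum_faults (fun k => f k i (j + 1)) S.L₁ hL₁,
      Qs.mulVec_sum_faults (fun k => f k (i + 1) j) S.L₂ hL₂, Matrix.mulVec_mulVec _ _ S.B₁,
      Matrix.mulVec_mulVec _ _ S.B₂]
    abel
  · intro i j hij
    rw [Matrix.fromCols_mulVec_sumElim, Matrix.zero_mulVec, zero_add, hy i j hij,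
      Matrix.mulVec_mulVec, Matrix.mulVec_mulVec, Qs.M_mul]

end QuotientSubsystem

end FMII


/-! ### Shift registers -/

namespace DetectionFilter

variable {n m q : ℕ}

/-- The filter equations on the half plane `i + j ≥ T`. -/
def IsStateEvolutionFrom (Φ : DetectionFilter m q) (T : ℤ) (ω : ℤ → ℤ → Fin Φ.o → ℝ)
    (u : ℤ → ℤ → Fin m → ℝ) (y : ℤ → ℤ → Fin q → ℝ) : Prop :=
  ∀ i j : ℤ, T ≤ i + j + 1 →
    ω (i + 1) (j + 1) = Φ.F₁ *ᵥ ω i (j + 1) + Φ.F₂ *ᵥ ω (i + 1) j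
      + Φ.K₁ *ᵥ u i (j + 1) + Φ.K₂ *ᵥ u (i + 1) j
      + Φ.E₁ *ᵥ y i (j + 1) + Φ.E₂ *ᵥ y (i + 1) j

/-- The cells of a shift register: the cell `(s, c)` stores the channel `c` of the input-output
signal with the delay `(s 0 + 1, s 1)`. -/
abbrev Cell (m q : ℕ) (t : Fin 2 →₀ ℕ) : Type := Finset.Icc 0 t × (Fin m ⊕ Fin q)

/-- The numbering of the cells. -/
def cellEquiv (m q : ℕ) (t : Fin 2 →₀ ℕ) : Cell m q t ≃ Fin (Fintype.card (Cell m q t)) :=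
  Fintype.equivFin _

/-- A shift register that stores the input and the output with all delays up to `t` and
reads out the combination of them with the coefficients of `p`. -/
def shiftRegister (t : Fin 2 →₀ ℕ) (p : Fin m ⊕ Fin q → Poly2) : DetectionFilter m q where
  o := Fintype.card (Cell m q t)
  F₁ := Matrix.submatrix (Matrix.of fun a b : Cell m q t =>
    if a.2 = b.2 ∧ a.1.1 = b.1.1 + Finsupp.single 0 1 then 1 else 0)
      (cellEquiv m q t).symm (cellEquiv m q t).symm
  -- The condition `a.1.1 0 = 0` gives each nonzero exponent a unique predecessor: samples are
  -- delayed first in `j`, then in `i`. Otherwise cells with both exponents positive would receive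
  -- two copies.
  F₂ := Matrix.submatrix (Matrix.of fun a b : Cell m q t =>
    if a.2 = b.2 ∧ a.1.1 0 = 0 ∧ a.1.1 = b.1.1 + Finsupp.single 1 1 then 1 else 0)
      (cellEquiv m q t).symm (cellEquiv m q t).symm
  -- Samples enter only through the neighbour `(i, j + 1)`, which causes the extra unit delay in the
  -- first direction.
  K₁ := Matrix.submatrix (Matrix.of fun (a : Cell m q t) (c : Fin m) =>
    if a.1.1 = 0 ∧ a.2 = Sum.inl c then 1 else 0) (cellEquiv m q t).symm id
  K₂ := 0
  E₁ := Matrix.submatrix (Matrix.of fun (a : Cell m q t) (c : Fin q) =>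
    if a.1.1 = 0 ∧ a.2 = Sum.inr c then 1 else 0) (cellEquiv m q t).symm id
  E₂ := 0
  M := fun a => (p ((cellEquiv m q t).symm a).2).coeff ((cellEquiv m q t).symm a).1.1
  H := 0

variable {t : Fin 2 →₀ ℕ} {p : Fin m ⊕ Fin q → Poly2}

/-- The update of a single cell. -/
theorem shiftRegister_step {T : ℤ} {ω : ℤ → ℤ → Fin (shiftRegister t p).o → ℝ}
    {u : ℤ → ℤ → Fin m → ℝ} {y : ℤ → ℤ → Fin q → ℝ}
    (hω : (shiftRegister t p).IsStateEvolutionFrom T ω u y) {i j : ℤ} (hij : T ≤ i + j + 1)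
    (a : Cell m q t) :
    ω (i + 1) (j + 1) (cellEquiv m q t a) =
      ∑ b : Cell m q t, (if a.2 = b.2 ∧ a.1.1 = b.1.1 + Finsupp.single 0 1 then 1 else 0) *
        ω i (j + 1) (cellEquiv m q t b) +
      ∑ b : Cell m q t,
        (if a.2 = b.2 ∧ a.1.1 0 = 0 ∧ a.1.1 = b.1.1 + Finsupp.single 1 1 then 1 else 0) *
          ω (i + 1) j (cellEquiv m q t b) +
      if a.1.1 = 0 then Sum.elim (u i (j + 1)) (y i (j + 1)) a.2 else 0 := by
  have hmul : ∀ (F : Matrix (Cell m q t) (Cell m q t) ℝ)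
      (v : Fin (Fintype.card (Cell m q t)) → ℝ),
      (F.submatrix (cellEquiv m q t).symm (cellEquiv m q t).symm *ᵥ v) (cellEquiv m q t a) =
        ∑ b, F a b * v (cellEquiv m q t b) := by
    intro F v
    rw [Matrix.submatrix_mulVec_equiv]
    simp [Matrix.mulVec, dotProduct]
  have hF₁ := hmul (Matrix.of fun a b : Cell m q t =>
    if a.2 = b.2 ∧ a.1.1 = b.1.1 + Finsupp.single 0 1 then 1 else 0) (ω i (j + 1))
  have hF₂ := hmul (Matrix.of fun a b : Cell m q t =>
    if a.2 = b.2 ∧ a.1.1 0 = 0 ∧ a.1.1 = b.1.1 + Finsupp.single 1 1 then 1 else 0) (ω (i + 1) j)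
  simp only [Matrix.of_apply] at hF₁ hF₂
  rw [← hF₁, ← hF₂, hω i j hij]
  have hin : ((shiftRegister t p).K₁ *ᵥ u i (j + 1)) (cellEquiv m q t a) +
      ((shiftRegister t p).E₁ *ᵥ y i (j + 1)) (cellEquiv m q t a) =
      if a.1.1 = 0 then Sum.elim (u i (j + 1)) (y i (j + 1)) a.2 else 0 := by
    obtain ⟨s, c⟩ := a
    rcases c with c | c <;> by_cases h : (s : Fin 2 →₀ ℕ) = 0 <;>
      simp [shiftRegister, Matrix.mulVec, dotProduct, h]
  rw [← hin, show (shiftRegister t p).K₂ = 0 from rfl, show (shiftRegister t p).E₂ = 0 from rfl,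
    Matrix.zero_mulVec, Matrix.zero_mulVec, add_zero, add_zero, add_assoc]
  rfl

/-- After a transient, each cell holds the delayed value it is meant to hold. -/
theorem shiftRegister_state {T : ℤ} {ω : ℤ → ℤ → Fin (shiftRegister t p).o → ℝ}
    {u : ℤ → ℤ → Fin m → ℝ} {y : ℤ → ℤ → Fin q → ℝ}
    (hω : (shiftRegister t p).IsStateEvolutionFrom T ω u y) (c : Fin m ⊕ Fin q) (k : ℕ) :
    ∀ s : Finset.Icc 0 t, s.1 0 + s.1 1 = k → ∀ i j : ℤ, T + k < i + j →
      ω i j (cellEquiv m q t (s, c)) =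
        Sum.elim (u (i - 1 - s.1 0) (j - s.1 1)) (y (i - 1 - s.1 0) (j - s.1 1)) c := by
  induction k with
  | zero =>
    intro s hs i j hij
    have h0 : s.1 0 = 0 := by lia
    have h1 : s.1 1 = 0 := by lia
    have hs0 : s.1 = 0 := by ext x; fin_cases x <;> simp [h0, h1]
    have hstep := shiftRegister_step hω (i := i - 1) (j := j - 1) (by lia) (s, c)
    have hne : ∀ (b : Finset.Icc 0 t) (x : Fin 2), s.1 ≠ b.1 + Finsupp.single x 1 := by
      intro b x hb
      have := DFunLike.congr_fun hb x
      simp [hs0] at this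
    simp only [sub_add_cancel, hne, and_false, if_false, zero_mul, Finset.sum_const_zero,
      zero_add] at hstep
    rw [hstep, if_pos hs0, h0, h1]
    simp
  | succ k ih =>
    intro s hs i j hij
    have hs0 : s.1 ≠ 0 := by
      intro h
      simp [h] at hs
    have hstep := shiftRegister_step hω (i := i - 1) (j := j - 1) (by push_cast at hij; lia) (s, c)
    simp only [sub_add_cancel, if_neg hs0, add_zero] at hstep
    -- `Finset.Icc 0 t` is closed downwards, so the predecessor of a cell is again a cell.
    have hpred : ∀ x : Fin 2, s.1 x ≠ 0 → ∃ b : Finset.Icc 0 t,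
        s.1 = b.1 + Finsupp.single x 1 := by
      intro x hx
      have hle : Finsupp.single x 1 ≤ s.1 := Finsupp.single_le_iff.2 (Nat.one_le_iff_ne_zero.2 hx)
      refine ⟨⟨s.1 - Finsupp.single x 1, Finset.mem_Icc.2 ⟨zero_le, ?_⟩⟩, ?_⟩
      · exact tsub_le_self.trans (Finset.mem_Icc.1 s.2).2
      · exact (tsub_add_cancel_of_le hle).symm
    by_cases h0 : s.1 0 = 0
    · obtain ⟨b, hb⟩ := hpred 1 (by lia)
      have hb0 : s.1 0 = b.1 0 := by rw [hb]; simp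
      have hb1 : s.1 1 = b.1 1 + 1 := by rw [hb]; simp
      have hne : ∀ b : Finset.Icc 0 t, s.1 ≠ b.1 + Finsupp.single 0 1 := by
        intro b hb
        have := DFunLike.congr_fun hb 0
        simp [h0] at this
      simp only [hne, and_false, if_false, zero_mul, Finset.sum_const_zero, zero_add] at hstep
      rw [Finset.sum_eq_single (b, c), if_pos ⟨rfl, h0, hb⟩, one_mul,
        ih b (by lia) i (j - 1) (by push_cast at hij; lia)] at hstep
      · rw [hstep, hb0, hb1]
        push_cast
        rw [sub_sub j 1, add_comm (1 : ℤ)]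
      · rintro ⟨b', c'⟩ - hbb
        rw [if_neg, zero_mul]
        rintro ⟨rfl, -, hb'⟩
        exact hbb (Prod.ext (Subtype.ext (add_right_cancel (hb'.symm.trans hb))) rfl)
      · exact fun h => absurd (Finset.mem_univ _) h
    · obtain ⟨b, hb⟩ := hpred 0 h0
      have hb0 : s.1 0 = b.1 0 + 1 := by rw [hb]; simp
      have hb1 : s.1 1 = b.1 1 := by rw [hb]; simp
      simp only [h0, false_and, and_false, if_false, zero_mul, Finset.sum_const_zero,
        add_zero] at hstep
      rw [Finset.sum_eq_single (b, c), if_pos ⟨rfl, hb⟩, one_mul,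
        ih b (by lia) (i - 1) j (by push_cast at hij; lia)] at hstep
      · rw [hstep, hb0, hb1]
        push_cast
        rw [sub_sub (i - 1) _ 1 |>.symm, sub_right_comm (i - 1)]
      · rintro ⟨b', c'⟩ - hbb
        rw [if_neg, zero_mul]
        rintro ⟨rfl, hb'⟩
        exact hbb (Prod.ext (Subtype.ext (add_right_cancel (hb'.symm.trans hb))) rfl)
      · exact fun h => absurd (Finset.mem_univ _) h

/-- Every polynomial in the delays of input and output is, up to a unit delay, the residual of a
detection filter. -/
theorem exists_realization (p : Fin m ⊕ Fin q → Poly2) :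
    ∃ (Φ : DetectionFilter m q) (N : ℕ), ∀ (T : ℤ) (ω u y),
      Φ.IsStateEvolutionFrom T ω u y → ∀ i j : ℤ, T + N < i + j →
        Φ.residual ω y i j = rowEval (fun i j => Sum.elim (u i j) (y i j)) (i - 1) j p := by
  obtain ⟨t, ht⟩ : ∃ t : Fin 2 →₀ ℕ, ∀ c, (p c).support ⊆ Finset.Icc 0 t := by
    -- The componentwise maximum of all exponents in all channels; cells outside a support are read
    -- out with coefficient 0.
    refine ⟨Finset.univ.sup fun c => (p c).support.sup id, fun c s hs => ?_⟩
    refine Finset.mem_Icc.2 ⟨zero_le, ?_⟩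
    exact (Finset.le_sup (f := id) hs).trans
      (Finset.le_sup (f := fun c => (p c).support.sup id) (Finset.mem_univ c))
  refine ⟨shiftRegister t p, t 0 + t 1, fun T ω u y hω i j hij => ?_⟩
  have hres : (shiftRegister t p).residual ω y i j =
      ∑ a : Cell m q t, (p a.2).coeff a.1.1 * ω i j (cellEquiv m q t a) := by
    rw [residual, show (shiftRegister t p).H = 0 from rfl, zero_dotProduct, sub_zero]
    refine ((cellEquiv m q t).sum_comp fun a =>
      (shiftRegister t p).M a * ω i j a).symm.trans ?_
    exact Finset.sum_congr rfl fun a _ => by simp [shiftRegister]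
  rw [hres, rowEval_apply, Fintype.sum_prod_type_right]
  refine Finset.sum_congr rfl fun c _ => ?_
  have hsub := Finset.sum_subset (f := fun s => (p c).coeff s *
    Sum.elim (u (i - 1 - s 0) (j - s 1)) (y (i - 1 - s 0) (j - s 1)) c) (ht c) ?_
  · rw [delayEval_eq_sum, hsub, ← Finset.sum_coe_sort (Finset.Icc 0 t)]
    refine Finset.sum_congr rfl fun s _ => ?_
    have hs := (Finset.mem_Icc.1 s.2).2
    have h0 := hs 0
    have h1 := hs 1
    rw [shiftRegister_state hω c _ s rfl i j (by push_cast at hij ⊢; lia)]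
  · intro s _ hs
    rw [MvPolynomial.notMem_support_iff.1 hs, zero_mul]

end DetectionFilter

/-! ### The delayed deadbeat filter -/

/-- The extension of a signal on the half plane `i + j ≥ 0` by zero. -/
def zeroExtend {E : Type} [Zero E] (g : ℤ → ℤ → E) (i j : ℤ) : E :=
  if 0 ≤ i + j then g i j else 0

theorem zeroExtend_of_nonneg {E : Type} [Zero E] (g : ℤ → ℤ → E) {i j : ℤ} (h : 0 ≤ i + j) :
    zeroExtend g i j = g i j := if_pos h

theorem zeroExtend_of_neg {E : Type} [Zero E] (g : ℤ → ℤ → E) {i j : ℤ} (h : i + j < 0) :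
    zeroExtend g i j = 0 := if_neg (not_le.2 h)

theorem zeroExtend_of_nonpos {E : Type} [Zero E] {g : ℤ → ℤ → E}
    (hg : ∀ i j : ℤ, i + j = 0 → g i j = 0) {i j : ℤ} (h : i + j ≤ 0) :
    zeroExtend g i j = 0 := by
  rcases h.lt_or_eq with h | h
  · exact zeroExtend_of_neg g h
  · rw [zeroExtend_of_nonneg g h.ge, hg i j h]

variable {n m q : ℕ}

/-- A trajectory that starts at rest extends by zero to all of `ℤ × ℤ`. -/
theorem FMII.IsTrajectory.zeroExtend {S : FMII n m q} {x u f y} (h : S.IsTrajectory x u f y)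
    (hx : ∀ i j : ℤ, i + j = 0 → x i j = 0) (T : ℤ) :
    S.IsTrajectoryFrom T (zeroExtend x) (zeroExtend u) (fun k => zeroExtend (f k))
      (zeroExtend y) := by
  refine ⟨fun i j _ => ?_, fun i j _ => ?_⟩
  · rcases le_or_gt 0 (i + j + 1) with hij | hij
    · simp only [zeroExtend_of_nonneg _ (show 0 ≤ i + 1 + (j + 1) by lia),
        zeroExtend_of_nonneg _ (show 0 ≤ i + (j + 1) by lia),
        zeroExtend_of_nonneg _ (show 0 ≤ i + 1 + j by lia)]
      exact h.1 i j hij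
    -- The left side may lie on `i + j = 0`, where the extension keeps the original value; here the
    -- zero initial values are needed.
    · rw [zeroExtend_of_nonpos hx (show i + 1 + (j + 1) ≤ 0 by lia)]
      simp only [zeroExtend_of_neg _ (show i + (j + 1) < 0 by lia),
        zeroExtend_of_neg _ (show i + 1 + j < 0 by lia)]
      simp
  · rcases le_or_gt 0 (i + j) with hij | hij
    · rw [zeroExtend_of_nonneg _ hij, zeroExtend_of_nonneg _ hij, h.2 i j hij]
    · rw [zeroExtend_of_neg _ hij, zeroExtend_of_neg _ hij, Matrix.mulVec_zero]

/-- A filter evolution that starts at rest extends by zero to all of `ℤ × ℤ`. -/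
theorem DetectionFilter.IsStateEvolution.zeroExtend {Φ : DetectionFilter m q} {ω u y}
    (h : Φ.IsStateEvolution ω u y) (hω : ∀ i j : ℤ, i + j = 0 → ω i j = 0) (T : ℤ) :
    Φ.IsStateEvolutionFrom T (zeroExtend ω) (zeroExtend u) (zeroExtend y) := by
  intro i j _
  rcases le_or_gt 0 (i + j + 1) with hij | hij
  · simp only [zeroExtend_of_nonneg _ (show 0 ≤ i + 1 + (j + 1) by lia),
      zeroExtend_of_nonneg _ (show 0 ≤ i + (j + 1) by lia),
      zeroExtend_of_nonneg _ (show 0 ≤ i + 1 + j by lia)]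
    exact h i j hij
  · rw [zeroExtend_of_nonpos hω (show i + 1 + (j + 1) ≤ 0 by lia)]
    simp only [zeroExtend_of_neg _ (show i + (j + 1) < 0 by lia),
      zeroExtend_of_neg _ (show i + 1 + j < 0 by lia)]
    simp

/-- A filter that reconstructs the fault up to a delay is a residual generator, if it does so
from every starting time. -/
theorem DetectionFilter.solves_of_reconstruction {S : FMII n m q} {k : Fin 2}
    {Φ : DetectionFilter m q} {n₁ n₂ N : ℕ} (hn : 0 < n₁ + n₂)
    (hΦ : ∀ (T : ℤ) (x u f y ω), S.IsTrajectoryFrom T x u f y →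
      Φ.IsStateEvolutionFrom T ω u y → ∀ i j : ℤ, T + N < i + j →
        Φ.residual ω y i j = f k (i - n₁) (j - n₂)) :
    Φ.IsResidualGenerator S k ∧ Φ.IsDelayedDeadbeat S k := by
  -- Adding `n₁ + n₂` to the transient keeps the delayed point `(i - n₁, j - n₂)` in the half plane.
  have hrun : ∀ x u f y ω, Φ.IsRun S x u f y ω → ∀ i j : ℤ, ((N + n₁ + n₂ : ℕ) : ℤ) < i + j →
      Φ.residual ω y i j = f k (i - n₁) (j - n₂) := by
    intro x u f y ω h i j hij
    exact hΦ 0 x u f y ω h.1 h.2 i j (by push_cast at hij; lia)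
  refine ⟨⟨?_, ⟨N + n₁ + n₂, ?_⟩, ?_⟩, n₁, n₂, N + n₁ + n₂, hn, by lia, hrun⟩
  · intro x u f y ω h hf
    have hev : ∀ᶠ a : ℤ in atTop, ((N + n₁ + n₂ : ℕ) : ℤ) < a := eventually_gt_atTop _
    refine tendsto_const_nhds.congr' ?_
    filter_upwards [hev.comap fun p : ℤ × ℤ => p.1 + p.2] with a ha
    rw [hrun x u f y ω h _ _ ha, hf _ _ (by push_cast at ha; lia)]
  · rintro x u f y ω h ⟨i, j, hij, hf⟩
    refine ⟨i + n₁, j + n₂, by lia, ?_⟩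
    rw [hrun x u f y ω h _ _ (by lia), add_sub_cancel_right, add_sub_cancel_right]
    exact hf
  · rintro x u f y ω h h0 ⟨i, j, hij, hf⟩
    refine ⟨i + n₁, j + n₂, by lia, ?_⟩
    -- Starting the zero extension at `-N - 1` ends the transient before `i + j = 0`, so the formula
    -- covers the whole half plane.
    have hr := hΦ (-N - 1) _ _ _ _ _ (h.1.zeroExtend (fun i j hij => (h0 i j hij).1) _)
      (h.2.zeroExtend (fun i j hij => (h0 i j hij).2) _) (i + n₁) (j + n₂) (by lia)
    rw [add_sub_cancel_right, add_sub_cancel_right, zeroExtend_of_nonneg _ hij, residual,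
      zeroExtend_of_nonneg _ (by lia), zeroExtend_of_nonneg _ (by lia)] at hr
    rw [residual, hr]
    exact hf

theorem FMII.GeometricCondition.solvableFor {S : FMII n m q} {k : Fin 2}
    (hk : S.GeometricCondition k) {d h : ℕ} {Qs : S.QuotientSubsystem k d h}
    (hQ : Qs.RankCondition) : S.SolvableFor k := by
  obtain ⟨e, N, p, hp⟩ := hQ.exists_reconstruction
  obtain ⟨Φ, N', hΦ⟩ := DetectionFilter.exists_realization p
  -- The reconstruction delays by `(e, e)` and the register by `(1, 0)`, so the total delay is
  -- nonzero even for `e = 0`. The `+ 1` in the transient pays for evaluating at `(i - 1, j)`.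
  refine ⟨hk.detectableIsolable, Φ, DetectionFilter.solves_of_reconstruction
    (n₁ := e + 1) (n₂ := e) (N := N + N' + 1) (by lia) ?_⟩
  intro T x u f y ω hx hω i j hij
  rw [hΦ T ω u y hω i j (by push_cast at hij; lia),
    hp T x u f y hx (i - 1) j (by push_cast at hij; lia)]
  push_cast
  rw [sub_sub, add_comm (1 : ℤ)]

end TwoDFDI

end

theorem mainTheorem7 {n m q : ℕ} (S : TwoDFDI.FMII n m q) :
    (∀ k : Fin 2, S.GeometricCondition k →
      ∀ (d h : ℕ) (Qs : S.QuotientSubsystem k d h), Qs.RankCondition → S.SolvableFor k) ∧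
    ((∀ k : Fin 2, S.GeometricCondition k ∧
        ∃ (d h : ℕ) (Qs : S.QuotientSubsystem k d h), Qs.RankCondition) → S.Solvable) := by
  refine ⟨fun k hk d h Qs hQ => hk.solvableFor hQ, fun H k => ?_⟩
  obtain ⟨hk, d, h, Qs, hQ⟩ := H k
  exact hk.solvableFor hQ
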